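/- Let $n,k,m,d$ be integers with $n,m\ge 0$ and $k,d\ge 1$. Let $I_1,\dots,I_k\subseteq\{1,\dots,n\}$ be pairwise disjoint sets of size at most $m$, let $f_i\colon\{0,1\}^{I_i}\to[-1,1]$ be arbitrary functions, and let $f\colon\{0,1\}^n\to[-1,1]$ be given by $f(x)=\prod_{i=1}^k f_i(x_{I_i})$, where $x_{I_i}$ denotes the bits of $x$ indexed by $I_i$ (such an $f$ is called a product test of $k$ functions with input length $m$). For $S\subseteq\{1,\dots,n\}$ let $\hat f_S=2^{-n}\sum_{x\in\{0,1\}^n} f(x)(-1)^{\sum_{i\in S}x_i}$ be the Fourier coefficient of $f$ at $S$, and let $W_{1,d}[f]=\sum_{|S|=d}|\hat f_S|$ be the $d$th level Fourier weight of $f$ in $L_1$-norm. Then $$W_{1,d}[f]\le\bigl(85\sqrt{m\ln(4ek)}\bigr)^d .$$ -/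

import Mathlib

namespace BoolCube

/-- The Boolean cube `{0,1}^n`. -/
abbrev Cube (n : ℕ) : Type := Fin n → Fin 2

/-- The character `χ_S(x) = (-1)^{∑_{i ∈ S} x_i}`. -/
def character {n : ℕ} (S : Finset (Fin n)) (x : Cube n) : ℝ :=
  (-1) ^ (∑ i ∈ S, (x i : ℕ))

/-- The expectation of `f` under the uniform distribution on `{0,1}^n`. -/
noncomputable def expectation {n : ℕ} (f : Cube n → ℝ) : ℝ :=
  (∑ x, f x) / 2 ^ n

/-- The Fourier coefficient of `f` at `S`, i.e. `E[f χ_S]`. -/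
noncomputable def coeff {n : ℕ} (f : Cube n → ℝ) (S : Finset (Fin n)) : ℝ :=
  expectation fun x => f x * character S x

/-- The `d`-th level Fourier weight of `f` in `L_q`-norm, the sum of `|coeff f S|^q` over all
`S` with exactly `d` elements. -/
noncomputable def fourierWeight {n : ℕ} (q : ℝ) (d : ℕ) (f : Cube n → ℝ) : ℝ :=
  ∑ S ∈ Finset.powersetCard d (Finset.univ : Finset (Fin n)), |coeff f S| ^ q

/-- `f` is a product test with `k` functions of input length `m`: there are pairwise disjoint
sets of coordinates `I_1, …, I_k` of size at most `m` and functions `g_i` of the bits indexed by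
`I_i`, with values in `[-1,1]`, such that `f` is the product of the `g_i`. -/
def IsProductTest {n : ℕ} (k m : ℕ) (f : Cube n → ℝ) : Prop :=
  ∃ I : Fin k → Finset (Fin n),
    (∀ i j, i ≠ j → Disjoint (I i) (I j)) ∧
    (∀ i, (I i).card ≤ m) ∧
    ∃ g : (i : Fin k) → ((I i) → Fin 2) → ℝ,
      (∀ i y, g i y ∈ Set.Icc (-1 : ℝ) 1) ∧
      ∀ x : Cube n, f x = ∏ i, g i (fun j : I i => x j)

end BoolCube

/-!
For `0 ≤ t` put `A_t(f) = ∑_S t^|S| |coeff f S|` (`fourierGen`). Then `t ^ d * W_{1,d}[f] ≤ A_t(f)`,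
and `A_t` is submultiplicative on functions of disjoint sets of coordinates (`fourierGen_mul_le`).
So it is enough to show that for `t` of order `1 / √(m log (4 e k))` every factor satisfies
`A_t(f_i) ≤ 1 + 1 / k` (`fourierGen_le_one_add_inv`): the product is then at most `e`, uniformly
in `d`.

For a single factor let `β = (1 - |E f_i|) / 2`, the expectation of the `[0,1]`-valued function
`h = (1 ∓ f_i) / 2`. By Cauchy–Schwarz over the nonempty `S ⊆ I_i`, weighted by `r ^ |S|`,
`A_t(f_i) ≤ 1 - 2 β + 2 √((1 + t² / r)^m - 1) √(∑_S r^|S| (coeff h S)²)`.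
The small-set inequality `sum_pow_card_mul_coeff_sq_le`, a consequence of hypercontractivity, bounds
the last square root by `β ^ (1 / (1 + q))` when `r = q / 6`. With `q = 1 / log (4 e k)` this
power is at most `e (β + 1 / (4 e k))` (`rpow_inv_one_add_inv_log_le`), so after multiplication
by the small factor `√((1 + t² / r)^m - 1)` the loss is absorbed by the gain `2 β`, up to `1 / k`.

The small-set inequality is proved by induction on the dimension, for two functions at once
(`noiseForm_le_rpow`), from the two-point inequality `two_point_rpow`; the latter follows from
`y ^ (1 + q) ≥ y + q y log y` and a quadratic lower bound for the binary entropy deficit.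
-/

namespace BoolCube

/-! ### Characters and Fourier coefficients -/

/-- The sign `(-1)^b` of a bit. -/
def bitSign (b : Fin 2) : ℝ := (-1) ^ (b : ℕ)

theorem bitSign_zero : bitSign 0 = 1 := by simp [bitSign]

theorem bitSign_one : bitSign 1 = -1 := by simp [bitSign]

theorem bitSign_mul_self (b : Fin 2) : bitSign b * bitSign b = 1 := by
  fin_cases b <;> simp [bitSign]

theorem bitSign_add_one (b : Fin 2) : bitSign (b + 1) = -bitSign b := by
  fin_cases b <;> simp [bitSign]

theorem bitSign_mul_of_ne {a b : Fin 2} (h : a ≠ b) : bitSign a * bitSign b = -1 := by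
  fin_cases a <;> fin_cases b <;> simp_all [bitSign]

variable {n : ℕ}

theorem character_eq_prod (S : Finset (Fin n)) (x : Cube n) :
    character S x = ∏ i ∈ S, bitSign (x i) := by
  simp [character, bitSign, Finset.prod_pow_eq_pow_sum]

theorem character_mul (S T : Finset (Fin n)) (x : Cube n) :
    character S x * character T x = character (symmDiff S T) x := by
  have h : ∀ U : Finset (Fin n), character U x = ∏ i, if i ∈ U then bitSign (x i) else 1 :=
    fun U => by simp [character_eq_prod]
  rw [h, h, h, ← Finset.prod_mul_distrib]
  refine Finset.prod_congr rfl fun i _ => ?_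
  by_cases hS : i ∈ S <;> by_cases hT : i ∈ T <;>
    simp [hS, hT, Finset.mem_symmDiff, bitSign_mul_self]

theorem sum_pow_card_mul_character_mul (r : ℝ) (x y : Cube n) :
    ∑ S : Finset (Fin n), r ^ S.card * (character S x * character S y)
      = ∏ i, (1 + r * (bitSign (x i) * bitSign (y i))) := by
  rw [Finset.prod_one_add, Finset.powerset_univ]
  refine Finset.sum_congr rfl fun S _ => ?_
  simp only [character_eq_prod, Finset.prod_mul_distrib, Finset.prod_const]

theorem sum_character_mul (x y : Cube n) :
    ∑ S : Finset (Fin n), character S x * character S y = if x = y then 2 ^ n else 0 := by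
  have h := sum_pow_card_mul_character_mul 1 x y
  simp only [one_pow, one_mul] at h
  rw [h]
  split_ifs with hxy
  · subst hxy
    norm_num [bitSign_mul_self]
  · obtain ⟨i, hi⟩ := Function.ne_iff.mp hxy
    exact Finset.prod_eq_zero (Finset.mem_univ i) (by rw [bitSign_mul_of_ne hi]; norm_num)

/-- Fourier inversion. -/
theorem sum_coeff_mul_character (f : Cube n → ℝ) (x : Cube n) :
    ∑ S, coeff f S * character S x = f x := by
  have h : ∀ S, coeff f S * character S x
      = (∑ y, f y * (character S y * character S x)) / 2 ^ n := fun S => by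
    simp only [coeff, expectation, div_mul_eq_mul_div, Finset.sum_mul, mul_assoc]
  simp only [h, ← Finset.sum_div]
  rw [Finset.sum_comm]
  simp [← Finset.mul_sum, sum_character_mul]

/-- The Fourier coefficients of a product are the convolution of the coefficients. -/
theorem coeff_mul (f g : Cube n → ℝ) (S : Finset (Fin n)) :
    coeff (fun x => f x * g x) S = ∑ T, coeff f T * coeff g (symmDiff S T) := by
  have h : ∀ x, f x * g x * character S x
      = ∑ T, coeff f T * (g x * character (symmDiff S T) x) := fun x => by
    rw [← sum_coeff_mul_character f x, Finset.sum_mul, Finset.sum_mul]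
    refine Finset.sum_congr rfl fun T _ => ?_
    rw [← character_mul]
    ring
  simp only [coeff.eq_1 (fun x => f x * g x), expectation, h]
  rw [Finset.sum_comm, Finset.sum_div]
  simp only [← Finset.mul_sum, mul_div_assoc]
  rfl

theorem coeff_eq_zero_of_dependsOn {f : Cube n → ℝ} {I S : Finset (Fin n)}
    (hf : DependsOn f I) (hS : ¬ S ⊆ I) : coeff f S = 0 := by
  obtain ⟨i, hiS, hiI⟩ := Finset.not_subset.mp hS
  have hchar : ∀ x : Cube n,
      character S (Function.update x i (x i + 1)) = -character S x := fun x => by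
    rw [character_eq_prod, character_eq_prod, ← Finset.mul_prod_erase _ _ hiS,
      ← Finset.mul_prod_erase S _ hiS, Function.update_self, bitSign_add_one, neg_mul]
    congr 2
    refine Finset.prod_congr rfl fun j hj => ?_
    rw [Function.update_of_ne (Finset.ne_of_mem_erase hj)]
  -- flipping the bit `i` preserves `f` and negates the character
  rw [coeff, expectation, Finset.sum_involution (fun x _ => Function.update x i (x i + 1)), zero_div]
  · intro x _
    have : f (Function.update x i (x i + 1)) = f x := hf fun j hj =>
      Function.update_of_ne (by rintro rfl; exact hiI hj) _ _
    rw [hchar, this]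
    ring
  · intro x _ _ h
    have := congrFun h i
    rw [Function.update_self] at this
    generalize x i = b at this
    fin_cases b <;> simp at this
  · simp
  · intro x _
    simp only [Function.update_self, Function.update_idem]
    rw [add_assoc, show (1 + 1 : Fin 2) = 0 from rfl, add_zero, Function.update_eq_self]

theorem coeff_const (c : ℝ) {S : Finset (Fin n)} (hS : S ≠ ∅) :
    coeff (fun _ : Cube n => c) S = 0 :=
  coeff_eq_zero_of_dependsOn (I := ∅) (fun _ _ _ => rfl) (by simpa using hS)

theorem coeff_empty (f : Cube n → ℝ) : coeff f ∅ = expectation f := by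
  simp [coeff, character]

/-! ### The generating function of the Fourier weights -/

/-- The generating function `∑_S t^|S| |coeff f S|` of the `L_1` Fourier weights of `f`, which
dominates `t^d` times the level-`d` weight for every `d`. -/
noncomputable def fourierGen (t : ℝ) (f : Cube n → ℝ) : ℝ :=
  ∑ S, t ^ S.card * |coeff f S|

theorem fourierGen_nonneg {t : ℝ} (ht : 0 ≤ t) (f : Cube n → ℝ) : 0 ≤ fourierGen t f :=
  Finset.sum_nonneg fun _ _ => by positivity

theorem pow_mul_fourierWeight_le {t : ℝ} (ht : 0 ≤ t) (d : ℕ) (f : Cube n → ℝ) :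
    t ^ d * fourierWeight 1 d f ≤ fourierGen t f := by
  rw [fourierWeight, Finset.mul_sum, fourierGen]
  refine (Finset.sum_congr rfl fun S hS => ?_).trans_le
    (Finset.sum_le_sum_of_subset_of_nonneg (Finset.subset_univ _) fun _ _ _ => by positivity)
  rw [Real.rpow_one, (Finset.mem_powersetCard.mp hS).2]

/-- On functions of disjoint sets of coordinates, `fourierGen` is submultiplicative: in the
convolution formula for the Fourier coefficients of the product, only terms with
`|S| = |T| + |S ∆ T|` survive. -/
theorem fourierGen_mul_le {t : ℝ} (ht : 0 ≤ t) {f g : Cube n → ℝ} {I J : Finset (Fin n)}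
    (hf : DependsOn f I) (hg : DependsOn g J) (hIJ : Disjoint I J) :
    fourierGen t (fun x => f x * g x) ≤ fourierGen t f * fourierGen t g := by
  have key : ∀ S T : Finset (Fin n), t ^ S.card * |coeff f T * coeff g (symmDiff S T)|
      = (t ^ T.card * |coeff f T|) * (t ^ (symmDiff S T).card * |coeff g (symmDiff S T)|) := by
    intro S T
    by_cases hT : T ⊆ I
    · by_cases hST : symmDiff S T ⊆ J
      · have hd : Disjoint T (symmDiff S T) := hIJ.mono hT hST
        have hS : S = T ∪ symmDiff S T := by
          have := hd.symmDiff_eq_sup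
          rw [← Finset.sup_eq_union, ← this, symmDiff_comm S T, symmDiff_symmDiff_cancel_left]
        have hcard : S.card = T.card + (symmDiff S T).card := by
          rw [← Finset.card_union_of_disjoint hd, ← hS]
        rw [hcard, abs_mul]
        ring
      · simp [coeff_eq_zero_of_dependsOn hg hST]
    · simp [coeff_eq_zero_of_dependsOn hf hT]
  calc fourierGen t (fun x => f x * g x)
      ≤ ∑ S, ∑ T, t ^ S.card * |coeff f T * coeff g (symmDiff S T)| := by
        refine Finset.sum_le_sum fun S _ => ?_
        rw [coeff_mul, ← Finset.mul_sum]
        exact mul_le_mul_of_nonneg_left (Finset.abs_sum_le_sum_abs _ _) (by positivity)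
    _ = ∑ T, ∑ S, (t ^ T.card * |coeff f T|) *
          (t ^ (symmDiff S T).card * |coeff g (symmDiff S T)|) := by
        rw [Finset.sum_comm]
        simp only [key]
    _ = fourierGen t f * fourierGen t g := by
        rw [fourierGen, Finset.sum_mul]
        refine Finset.sum_congr rfl fun T _ => ?_
        rw [← Finset.mul_sum, fourierGen]
        congr 1
        exact Equiv.sum_comp (symmDiff_left_involutive T).toPerm
          (fun U => t ^ U.card * |coeff g U|)

theorem fourierGen_one (t : ℝ) : fourierGen t (fun _ : Cube n => 1) = 1 := by
  rw [fourierGen, Finset.sum_eq_single ∅ (fun S _ hS => by simp [coeff_const 1 hS]) (by simp)]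
  simp [coeff_empty, expectation]

theorem dependsOn_prod {ι : Type*} [DecidableEq ι] {F : ι → Cube n → ℝ}
    {I : ι → Finset (Fin n)} (hF : ∀ i, DependsOn (F i) (I i)) (s : Finset ι) :
    DependsOn (fun x => ∏ i ∈ s, F i x) (s.biUnion I : Finset (Fin n)) :=
  fun _ _ h => Finset.prod_congr rfl fun i hi =>
    hF i fun j hj => h j (Finset.mem_coe.mpr (Finset.mem_biUnion.mpr ⟨i, hi, hj⟩))

theorem fourierGen_prod_le {ι : Type*} [DecidableEq ι] {t : ℝ} (ht : 0 ≤ t)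
    {F : ι → Cube n → ℝ} {I : ι → Finset (Fin n)} (hF : ∀ i, DependsOn (F i) (I i))
    (hI : ∀ i j, i ≠ j → Disjoint (I i) (I j)) (s : Finset ι) :
    fourierGen t (fun x => ∏ i ∈ s, F i x) ≤ ∏ i ∈ s, fourierGen t (F i) := by
  induction s using Finset.induction_on with
  | empty => simp [fourierGen_one]
  | insert a s ha ih =>
    simp only [Finset.prod_insert ha]
    refine (fourierGen_mul_le ht (hF a) (dependsOn_prod hF s) ?_).trans
      (mul_le_mul_of_nonneg_left ih (fourierGen_nonneg ht _))
    rw [Finset.disjoint_biUnion_right]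
    exact fun i hi => hI a i (by rintro rfl; exact ha hi)

/-! ### The two-point inequality -/

/-- A weak form of Pinsker's inequality for a biased bit. -/
theorem sq_div_three_le_entropy {x : ℝ} (h0 : 0 ≤ x) (h1 : x ≤ 1) :
    x ^ 2 / 3 ≤ (1 + x) * Real.log (1 + x) + (1 - x) * Real.log (1 - x) := by
  have hpos : x + x ^ 2 / 3 ≤ (1 + x) * Real.log (1 + x) := by
    refine le_trans ?_ (mul_le_mul_of_nonneg_left (Real.le_log_one_add_of_nonneg h0) (by linarith))
    rw [← mul_div_assoc, le_div_iff₀ (by linarith)]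
    nlinarith [mul_nonneg (sq_nonneg x) (sub_nonneg.mpr h1)]
  have hneg : -x ≤ (1 - x) * Real.log (1 - x) := by
    rcases h1.eq_or_lt with rfl | h1
    · simp
    · have hx : 0 < 1 - x := by linarith
      calc -x = (1 - x) * (1 - (1 - x)⁻¹) := by field_simp; ring
        _ ≤ _ := mul_le_mul_of_nonneg_left (Real.one_sub_inv_le_log_of_pos hx) hx.le
  linarith

/-- From `y ^ q = exp (q log y) ≥ 1 + q log y`. -/
theorem add_mul_log_le_rpow {q y : ℝ} (hq : 0 ≤ q) (hy : 0 ≤ y) :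
    y + q * (y * Real.log y) ≤ y ^ (1 + q) := by
  rcases hy.eq_or_lt with rfl | hy
  · rw [Real.zero_rpow (by linarith)]; simp
  · rw [Real.rpow_add hy, Real.rpow_one, Real.rpow_def_of_pos hy q]
    have := mul_le_mul_of_nonneg_left (Real.add_one_le_exp (Real.log y * q)) hy.le
    linarith

theorem one_add_sq_le_rpow_average {q x : ℝ} (hq : 0 ≤ q) (h0 : 0 ≤ x) (h1 : x ≤ 1) :
    1 + q / 6 * x ^ 2 ≤ ((1 + x) ^ (1 + q) + (1 - x) ^ (1 + q)) / 2 := by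
  have a := add_mul_log_le_rpow hq (by linarith : 0 ≤ 1 + x)
  have b := add_mul_log_le_rpow hq (by linarith : 0 ≤ 1 - x)
  have c := mul_le_mul_of_nonneg_left (sq_div_three_le_entropy h0 h1) hq
  linarith

/-- The two-point inequality in homogeneous form: after scaling to `u = 1 + x`, `v = 1 - x`,
Bernoulli's inequality bounds the left side by `1 + (q / 6) x²`. -/
theorem two_point_rpow_of_le {q u v : ℝ} (hq : 0 ≤ q) (hq1 : q ≤ 1) (hv : 0 ≤ v) (hvu : v ≤ u) :
    (((u + v) / 2) ^ 2 + q / 6 * ((u - v) / 2) ^ 2) ^ ((1 + q) / 2)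
      ≤ (u ^ (1 + q) + v ^ (1 + q)) / 2 := by
  rcases (add_nonneg (hv.trans hvu) hv).eq_or_lt with h0 | hs
  · obtain rfl : v = 0 := by linarith
    obtain rfl : u = 0 := by linarith
    rw [Real.zero_rpow (by linarith)]
    norm_num
    rw [Real.zero_rpow (by linarith)]
  · obtain ⟨s, hs'⟩ : ∃ s, s = (u + v) / 2 := ⟨_, rfl⟩
    obtain ⟨x, hx⟩ : ∃ x, x = (u - v) / (u + v) := ⟨_, rfl⟩
    have hspos : 0 < s := by linarith
    have hx0 : 0 ≤ x := hx ▸ div_nonneg (by linarith) hs.le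
    have hx1 : x ≤ 1 := hx ▸ (div_le_one hs).mpr (by linarith)
    have hu : u = s * (1 + x) := by rw [hs', hx]; field_simp; ring
    have hv' : v = s * (1 - x) := by rw [hs', hx]; field_simp; ring
    have hL : ((u + v) / 2) ^ 2 + q / 6 * ((u - v) / 2) ^ 2
        = s ^ 2 * (1 + q / 6 * x ^ 2) := by rw [hu, hv']; ring
    have hsq : (s ^ 2) ^ ((1 + q) / 2) = s ^ (1 + q) := by
      rw [← Real.rpow_natCast, ← Real.rpow_mul hspos.le]
      congr 1
      push_cast
      ring
    have hz : 0 ≤ q / 6 * x ^ 2 := by positivity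
    rw [hL, hu, hv', Real.mul_rpow hspos.le (by linarith), Real.mul_rpow hspos.le (by linarith),
      Real.mul_rpow (by positivity) (by positivity), hsq, ← mul_add, mul_div_assoc]
    refine mul_le_mul_of_nonneg_left ?_ (by positivity)
    calc (1 + q / 6 * x ^ 2) ^ ((1 + q) / 2) ≤ 1 + (1 + q) / 2 * (q / 6 * x ^ 2) :=
          rpow_one_add_le_one_add_mul_self (by linarith) (by linarith) (by linarith)
      _ ≤ 1 + q / 6 * x ^ 2 := by
          have : (1 + q) / 2 * (q / 6 * x ^ 2) ≤ 1 * (q / 6 * x ^ 2) :=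
            mul_le_mul_of_nonneg_right (by linarith) hz
          linarith
      _ ≤ _ := one_add_sq_le_rpow_average hq hx0 hx1

/-- The two-point hypercontractive inequality, with a constant that is not optimal, written in
terms of `a = u ^ (1 + q)` and `b = v ^ (1 + q)`. -/
theorem two_point_rpow {q a b : ℝ} (hq : 0 ≤ q) (hq1 : q ≤ 1) (ha : 0 ≤ a) (hb : 0 ≤ b) :
    ((a ^ (1 + q)⁻¹ + b ^ (1 + q)⁻¹) / 2) ^ 2 + q / 6 * ((a ^ (1 + q)⁻¹ - b ^ (1 + q)⁻¹) / 2) ^ 2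
      ≤ (((a + b) / 2) ^ (1 + q)⁻¹) ^ 2 := by
  wlog hba : b ≤ a generalizing a b
  · have := this hb ha (le_of_not_ge hba)
    rw [add_comm b a] at this
    exact le_of_eq_of_le (by ring) this
  have hp : (1 + q) ≠ 0 := by linarith
  have h := two_point_rpow_of_le hq hq1 (Real.rpow_nonneg hb (1 + q)⁻¹)
    (Real.rpow_le_rpow hb hba (by positivity))
  rw [Real.rpow_inv_rpow ha hp, Real.rpow_inv_rpow hb hp] at h
  have h2 := Real.rpow_le_rpow (by positivity) h (by positivity : 0 ≤ 2 * (1 + q)⁻¹)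
  rw [← Real.rpow_mul (by positivity), show (1 + q) / 2 * (2 * (1 + q)⁻¹) = 1 by field_simp,
    Real.rpow_one] at h2
  refine h2.trans_eq ?_
  rw [mul_comm, Real.rpow_mul (by positivity), Real.rpow_two]

/-! ### The small-set inequality -/

theorem expectation_succ {n : ℕ} (f : Cube (n + 1) → ℝ) :
    expectation f = (expectation (fun x => f (Fin.cons 0 x))
      + expectation (fun x => f (Fin.cons 1 x))) / 2 := by
  have h : ∑ x, f x = ∑ x, f (Fin.cons 0 x) + ∑ x, f (Fin.cons 1 x) := by
    rw [← Fin.sum_univ_two (fun b : Fin 2 => ∑ x : Cube n, f (Fin.cons b x)),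
      ← Fintype.sum_prod_type' (fun (b : Fin 2) (x : Cube n) => f (Fin.cons b x))]
    exact (Equiv.sum_comp (Fin.consEquiv fun _ => Fin 2) f).symm
  simp only [expectation, h, pow_succ]
  field_simp

theorem expectation_add {n : ℕ} (f g : Cube n → ℝ) :
    expectation (fun x => f x + g x) = expectation f + expectation g := by
  simp [expectation, Finset.sum_add_distrib, add_div]

theorem expectation_const_mul {n : ℕ} (c : ℝ) (f : Cube n → ℝ) :
    expectation (fun x => c * f x) = c * expectation f := by
  simp [expectation, ← Finset.mul_sum, mul_div_assoc]

theorem expectation_nonneg {n : ℕ} {f : Cube n → ℝ} (hf : ∀ x, 0 ≤ f x) : 0 ≤ expectation f :=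
  div_nonneg (Finset.sum_nonneg fun x _ => hf x) (by positivity)

/-- The noise form `⟨f, T_r g⟩ = ∑_S r^|S| (coeff f S) (coeff g S)`, written through its kernel
`∏ i, (1 + r (-1)^(x_i + y_i))`. -/
noncomputable def noiseForm {n : ℕ} (r : ℝ) (f g : Cube n → ℝ) : ℝ :=
  expectation fun x => expectation fun y =>
    (∏ i, (1 + r * (bitSign (x i) * bitSign (y i)))) * (f x * g y)

theorem noiseForm_eq_sum {n : ℕ} (r : ℝ) (f g : Cube n → ℝ) :
    noiseForm r f g = ∑ S, r ^ S.card * (coeff f S * coeff g S) := by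
  simp only [noiseForm, ← sum_pow_card_mul_character_mul, coeff, expectation]
  have h : ∀ S : Finset (Fin n), r ^ S.card * ((∑ x, f x * character S x) / 2 ^ n *
      ((∑ x, g x * character S x) / 2 ^ n)) = (∑ x, (∑ y, r ^ S.card *
        (character S x * character S y) * (f x * g y)) / 2 ^ n) / 2 ^ n := fun S => by
    rw [div_mul_div_comm, Finset.sum_mul_sum, ← Finset.sum_div, div_div, ← mul_div_assoc,
      Finset.mul_sum]
    simp only [Finset.mul_sum]
    congr 1
    refine Finset.sum_congr rfl fun x _ => Finset.sum_congr rfl fun y _ => ?_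
    ring
  simp only [h, ← Finset.sum_div, Finset.sum_mul]
  congr 2
  refine Eq.trans ?_ Finset.sum_comm
  exact Finset.sum_congr rfl fun x _ => Finset.sum_comm

theorem noiseForm_succ {n : ℕ} (r : ℝ) (f g : Cube (n + 1) → ℝ) :
    noiseForm r f g =
      ((1 + r) * (noiseForm r (fun x => f (Fin.cons 0 x)) (fun x => g (Fin.cons 0 x))
          + noiseForm r (fun x => f (Fin.cons 1 x)) (fun x => g (Fin.cons 1 x)))
        + (1 - r) * (noiseForm r (fun x => f (Fin.cons 0 x)) (fun x => g (Fin.cons 1 x))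
          + noiseForm r (fun x => f (Fin.cons 1 x)) (fun x => g (Fin.cons 0 x)))) / 4 := by
  have h : ∀ b c : Fin 2, (expectation fun x : Cube n => expectation fun y : Cube n =>
      (∏ i, (1 + r * (bitSign ((Fin.cons b x : Cube (n + 1)) i)
        * bitSign ((Fin.cons c y : Cube (n + 1)) i)))) * (f (Fin.cons b x) * g (Fin.cons c y)))
      = (1 + r * (bitSign b * bitSign c))
        * noiseForm r (fun x => f (Fin.cons b x)) (fun x => g (Fin.cons c x)) := fun b c => by
    simp only [noiseForm, Fin.prod_univ_succ, Fin.cons_zero, Fin.cons_succ, mul_assoc,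
      expectation_const_mul]
  have hx : ∀ b : Fin 2, (expectation fun x : Cube n => expectation fun y : Cube (n + 1) =>
      (∏ i, (1 + r * (bitSign ((Fin.cons b x : Cube (n + 1)) i) * bitSign (y i))))
        * (f (Fin.cons b x) * g y))
      = ((1 + r * bitSign b) * noiseForm r (fun x => f (Fin.cons b x)) (fun x => g (Fin.cons 0 x))
        + (1 - r * bitSign b)
          * noiseForm r (fun x => f (Fin.cons b x)) (fun x => g (Fin.cons 1 x))) / 2 := fun b => by
    simp only [expectation_succ (fun y : Cube (n + 1) => _), div_eq_inv_mul,
      expectation_const_mul, expectation_add, h, bitSign_zero, bitSign_one]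
    ring
  rw [noiseForm, expectation_succ, hx, hx, bitSign_zero, bitSign_one]
  ring

/-- A two-function small-set inequality: for `[0,1]`-valued `f` and `g` the noise form with
parameter `q / 6` is at most `(E f · E g) ^ (1 / (1 + q))`. Stating it for two functions makes
induction on the dimension work: both halves of the cube are combined by Cauchy–Schwarz and the
two-point inequality. -/
theorem noiseForm_le_rpow {q : ℝ} (hq : 0 ≤ q) (hq1 : q ≤ 1) {n : ℕ} (f g : Cube n → ℝ)
    (hf : ∀ x, f x ∈ Set.Icc (0 : ℝ) 1) (hg : ∀ x, g x ∈ Set.Icc (0 : ℝ) 1) :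
    noiseForm (q / 6) f g ≤ expectation f ^ (1 + q)⁻¹ * expectation g ^ (1 + q)⁻¹ := by
  induction n with
  | zero =>
    have hle : ∀ a : ℝ, a ∈ Set.Icc (0 : ℝ) 1 → a ≤ a ^ (1 + q)⁻¹ := fun a ha =>
      Real.self_le_rpow_of_le_one ha.1 ha.2 (inv_le_one_of_one_le₀ (by linarith))
    simp only [noiseForm, expectation, Fintype.sum_unique, Finset.univ_eq_empty,
      Finset.prod_empty, pow_zero, div_one, one_mul]
    exact mul_le_mul (hle _ (hf _)) (hle _ (hg _)) (hg _).1 (Real.rpow_nonneg (hf _).1 _)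
  | succ n ih =>
    rw [noiseForm_succ, expectation_succ f, expectation_succ g]
    have hEf := fun b : Fin 2 => expectation_nonneg fun x : Cube n => (hf (Fin.cons b x)).1
    have hEg := fun b : Fin 2 => expectation_nonneg fun x : Cube n => (hg (Fin.cons b x)).1
    have key := fun b c : Fin 2 => ih (fun x => f (Fin.cons b x)) (fun x => g (Fin.cons c x))
      (fun x => hf _) (fun x => hg _)
    have tf := two_point_rpow hq hq1 (hEf 0) (hEf 1)
    have tg := two_point_rpow hq hq1 (hEg 0) (hEg 1)
    have nf := Real.rpow_nonneg (by linarith [hEf 0, hEf 1] :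
      0 ≤ (expectation (fun x => f (Fin.cons 0 x)) + expectation (fun x => f (Fin.cons 1 x))) / 2)
      (1 + q)⁻¹
    have ng := Real.rpow_nonneg (by linarith [hEg 0, hEg 1] :
      0 ≤ (expectation (fun x => g (Fin.cons 0 x)) + expectation (fun x => g (Fin.cons 1 x))) / 2)
      (1 + q)⁻¹
    have k00 := key 0 0
    have k01 := key 0 1
    have k10 := key 1 0
    have k11 := key 1 1
    clear key hEf hEg ih
    generalize expectation (fun x => f (Fin.cons 0 x)) ^ (1 + q)⁻¹ = a₀ at *
    generalize expectation (fun x => f (Fin.cons 1 x)) ^ (1 + q)⁻¹ = a₁ at *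
    generalize expectation (fun x => g (Fin.cons 0 x)) ^ (1 + q)⁻¹ = b₀ at *
    generalize expectation (fun x => g (Fin.cons 1 x)) ^ (1 + q)⁻¹ = b₁ at *
    generalize ((expectation (fun x => f (Fin.cons 0 x))
      + expectation (fun x => f (Fin.cons 1 x))) / 2) ^ (1 + q)⁻¹ = A at *
    generalize ((expectation (fun x => g (Fin.cons 0 x))
      + expectation (fun x => g (Fin.cons 1 x))) / 2) ^ (1 + q)⁻¹ = B at *
    calc _ ≤ ((1 + q / 6) * (a₀ * b₀ + a₁ * b₁) + (1 - q / 6) * (a₀ * b₁ + a₁ * b₀)) / 4 := by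
          gcongr
          linarith
      _ = (a₀ + a₁) / 2 * ((b₀ + b₁) / 2) + q / 6 * ((a₀ - a₁) / 2 * ((b₀ - b₁) / 2)) := by ring
      _ ≤ A * B := by
          refine abs_le_of_sq_le_sq' ?_ (mul_nonneg nf ng) |>.2
          -- Cauchy–Schwarz for the form `u v + (q / 6) u' v'`
          calc _ ≤ (((a₀ + a₁) / 2) ^ 2 + q / 6 * ((a₀ - a₁) / 2) ^ 2)
                * (((b₀ + b₁) / 2) ^ 2 + q / 6 * ((b₀ - b₁) / 2) ^ 2) := by
                have : 0 ≤ q / 6 * ((a₀ + a₁) / 2 * ((b₀ - b₁) / 2)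
                  - (a₀ - a₁) / 2 * ((b₀ + b₁) / 2)) ^ 2 := by positivity
                linarith
            _ ≤ A ^ 2 * B ^ 2 := mul_le_mul tf tg (by positivity) (by positivity)
            _ = (A * B) ^ 2 := by ring

/-- The small-set inequality: a `[0,1]`-valued function of small expectation has little
low-level Fourier weight. -/
theorem sum_pow_card_mul_coeff_sq_le {q : ℝ} (hq : 0 ≤ q) (hq1 : q ≤ 1) {n : ℕ}
    {f : Cube n → ℝ} (hf : ∀ x, f x ∈ Set.Icc (0 : ℝ) 1) :
    ∑ S, (q / 6) ^ S.card * coeff f S ^ 2 ≤ (expectation f ^ (1 + q)⁻¹) ^ 2 := by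
  have h := noiseForm_le_rpow hq hq1 f f hf hf
  rw [noiseForm_eq_sum] at h
  simpa only [sq] using h

/-! ### The bound for a single factor -/

theorem coeff_const_add_mul {n : ℕ} (a b : ℝ) (f : Cube n → ℝ) {S : Finset (Fin n)}
    (hS : S ≠ ∅) : coeff (fun x => a + b * f x) S = b * coeff f S := by
  have h := coeff_const (n := n) a hS
  simp only [coeff, add_mul, mul_assoc, expectation_add, expectation_const_mul] at h ⊢
  linarith

theorem expectation_const {n : ℕ} (c : ℝ) : expectation (fun _ : Cube n => c) = c := by
  simp [expectation]

theorem sum_pow_card_powerset_erase {α : Type*} [DecidableEq α] (y : ℝ) (I : Finset α) :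
    ∑ S ∈ I.powerset.erase ∅, y ^ S.card = (1 + y) ^ I.card - 1 := by
  have h := Finset.sum_pow_mul_eq_add_pow y 1 I
  simp only [one_pow, mul_one] at h
  rw [add_comm 1 y, ← h, ← Finset.add_sum_erase _ _ (Finset.empty_mem_powerset I)]
  simp

/-- The Cauchy–Schwarz step: the contribution of the nonempty sets to `fourierGen t f` is
controlled by the small-set inequality for the `[0,1]`-valued function `(1 ∓ f) / 2`, whose
expectation is `(1 - |E f|) / 2`. -/
theorem fourierGen_le_abs_expectation_add {n : ℕ} {f : Cube n → ℝ} {I : Finset (Fin n)}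
    (hf : ∀ x, f x ∈ Set.Icc (-1 : ℝ) 1) (hI : DependsOn f I) {t q : ℝ} (hq : 0 < q)
    (hq1 : q ≤ 1) :
    fourierGen t f ≤ |expectation f| + 2 * (√((1 + t ^ 2 / (q / 6)) ^ I.card - 1)
      * ((1 - |expectation f|) / 2) ^ (1 + q)⁻¹) := by
  obtain ⟨σ, hσ, hσf⟩ : ∃ σ : ℝ, |σ| = 1 ∧ |expectation f| = σ * expectation f := by
    rcases abs_choice (expectation f) with h | h
    · exact ⟨1, by simp, by rw [h, one_mul]⟩
    · exact ⟨-1, by simp, by rw [h, neg_one_mul]⟩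
  have hE : expectation (fun x => 1 / 2 + -σ / 2 * f x) = (1 - |expectation f|) / 2 := by
    rw [expectation_add, expectation_const, expectation_const_mul, hσf]
    ring
  have hmem : ∀ x, 1 / 2 + -σ / 2 * f x ∈ Set.Icc (0 : ℝ) 1 := fun x => by
    have : |σ * f x| ≤ 1 := by
      rw [abs_mul, hσ, one_mul]
      exact abs_le.mpr (hf x)
    have := abs_le.mp this
    constructor <;> linarith [this.1, this.2]
  have hsmall := sum_pow_card_mul_coeff_sq_le hq.le hq1 hmem
  rw [hE] at hsmall
  have hβ : 0 ≤ (1 - |expectation f|) / 2 := hE ▸ expectation_nonneg fun x => (hmem x).1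
  have hr : 0 < q / 6 := by positivity
  have hterm : ∀ S ∈ I.powerset.erase ∅, t ^ S.card * |coeff f S|
      = 2 * ((t / √(q / 6)) ^ S.card
        * (√(q / 6) ^ S.card * |coeff (fun x => 1 / 2 + -σ / 2 * f x) S|)) := fun S hS => by
    rw [coeff_const_add_mul _ _ _ (Finset.ne_of_mem_erase hS), abs_mul, abs_div, abs_neg, hσ,
      ← mul_assoc (_ ^ _), ← mul_pow, div_mul_cancel₀ _ (Real.sqrt_pos.mpr hr).ne']
    norm_num
    ring
  have hsplit : fourierGen t f
      = |expectation f| + ∑ S ∈ I.powerset.erase ∅, t ^ S.card * |coeff f S| := by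
    have h0 : t ^ (∅ : Finset (Fin n)).card * |coeff f ∅| = |expectation f| := by
      simp [coeff_empty]
    rw [fourierGen, ← h0, Finset.add_sum_erase _ (fun S => t ^ S.card * |coeff f S|)
      (Finset.empty_mem_powerset I)]
    refine (Finset.sum_subset (Finset.subset_univ _) fun S _ hS => ?_).symm
    rw [coeff_eq_zero_of_dependsOn hI (by simpa using hS), abs_zero, mul_zero]
  rw [hsplit, Finset.sum_congr rfl hterm, ← Finset.mul_sum]
  gcongr
  refine (Real.sum_mul_le_sqrt_mul_sqrt _ _ _).trans ?_
  gcongr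
  · refine le_of_eq ?_
    rw [← sum_pow_card_powerset_erase]
    refine Finset.sum_congr rfl fun S _ => ?_
    rw [← pow_mul, mul_comm S.card, pow_mul, div_pow, Real.sq_sqrt hr.le]
  · rw [Real.sqrt_le_left (Real.rpow_nonneg hβ _)]
    refine le_trans ?_ hsmall
    refine (Finset.sum_congr rfl fun S _ => ?_).trans_le
      (Finset.sum_le_sum_of_subset_of_nonneg (Finset.subset_univ _) fun _ _ _ => by positivity)
    rw [mul_pow, sq_abs, ← pow_mul, mul_comm S.card, pow_mul, Real.sq_sqrt hr.le]

/-- Since `K ^ (1 / log K) = e`, raising to the power `1 / (1 + 1 / log K)` costs only a factor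
`e` on numbers that are at least `1 / K`. -/
theorem rpow_inv_one_add_inv_log_le {K β : ℝ} (hK : 1 ≤ Real.log K) (hK0 : 0 < K) (hβ : 0 ≤ β) :
    β ^ (1 + (Real.log K)⁻¹)⁻¹ ≤ Real.exp 1 * (β + 1 / K) := by
  have hq : 0 < (Real.log K)⁻¹ := by positivity
  have hKinv : 0 < 1 / K := by positivity
  have hb : 0 < β + 1 / K := by positivity
  have hθ : (1 + (Real.log K)⁻¹)⁻¹ ≤ 1 := inv_le_one_of_one_le₀ (by linarith)
  have hθ' : 1 - (Real.log K)⁻¹ ≤ (1 + (Real.log K)⁻¹)⁻¹ := by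
    rw [← one_div (1 + _), le_div_iff₀ (by linarith)]
    nlinarith [sq_nonneg (Real.log K)⁻¹]
  generalize (1 + (Real.log K)⁻¹)⁻¹ = θ at *
  have hθ0 : 0 ≤ θ := le_trans (sub_nonneg.mpr (inv_le_one_of_one_le₀ hK)) hθ'
  have hK1 : 1 ≤ K := by
    by_contra h
    linarith [Real.log_nonpos hK0.le (not_le.mp h).le]
  calc β ^ θ ≤ (β + 1 / K) ^ θ := Real.rpow_le_rpow hβ (by linarith) hθ0
    _ = (β + 1 / K) ^ (θ - 1) * (β + 1 / K) := by
        rw [Real.rpow_sub_one hb.ne', div_mul_cancel₀ _ hb.ne']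
    _ ≤ (1 / K) ^ (θ - 1) * (β + 1 / K) := by
        gcongr ?_ * _
        exact Real.rpow_le_rpow_of_nonpos hKinv (by linarith) (by linarith)
    _ ≤ Real.exp 1 * (β + 1 / K) := by
        gcongr ?_ * _
        rw [one_div, Real.inv_rpow hK0.le, ← Real.rpow_neg hK0.le]
        calc K ^ (-(θ - 1)) ≤ K ^ (Real.log K)⁻¹ :=
              Real.rpow_le_rpow_of_exponent_le hK1 (by linarith)
          _ = Real.exp 1 := by
              rw [Real.rpow_def_of_pos hK0, mul_inv_cancel₀ (by linarith)]

/-- The combinatorial factor `√((1 + t² / r)^|I| - 1)` for the values of `t` and `r` used below,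
for which `t² / r = 1 / (150 m)`. -/
theorem sqrt_one_add_pow_sub_one_le {m c : ℕ} (hm : 0 < m) (hc : c ≤ m) :
    √((1 + 1 / (150 * (m : ℝ))) ^ c - 1) ≤ 1 / 3 := by
  have hm' : (0 : ℝ) < m := by exact_mod_cast hm
  have h : (1 + 1 / (150 * (m : ℝ))) ^ c ≤ 150 / 149 := by
    calc (1 + 1 / (150 * (m : ℝ))) ^ c ≤ (1 + 1 / (150 * (m : ℝ))) ^ m :=
          pow_le_pow_right₀ (by simp) hc
      _ ≤ Real.exp (1 / (150 * (m : ℝ))) ^ m := by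
          gcongr
          rw [add_comm]
          exact Real.add_one_le_exp _
      _ = Real.exp (1 / 150) := by
          rw [← Real.exp_nat_mul]
          congr 1
          field_simp
      _ ≤ 150 / 149 := by
          have := Real.one_sub_le_exp_neg (1 / 150)
          rw [Real.exp_neg, le_inv_comm₀ (by norm_num) (Real.exp_pos _)] at this
          norm_num at this ⊢
          exact this
  rw [Real.sqrt_le_left (by norm_num)]
  linarith

/-- At `t = 1 / (30 √(m log (4 e k)))` every factor of a product test contributes at most
`1 + 1 / k`. -/
theorem fourierGen_le_one_add_inv {n k m : ℕ} (hk : 0 < k) (hm : 0 < m) {f : Cube n → ℝ}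
    {I : Finset (Fin n)} (hf : ∀ x, f x ∈ Set.Icc (-1 : ℝ) 1) (hI : DependsOn f I)
    (hIm : I.card ≤ m) :
    fourierGen (30 * √((m : ℝ) * Real.log (4 * Real.exp 1 * (k : ℝ))))⁻¹ f ≤ 1 + 1 / (k : ℝ) := by
  have hk' : (1 : ℝ) ≤ k := by exact_mod_cast hk
  have hm' : (0 : ℝ) < m := by exact_mod_cast hm
  have he := Real.exp_pos 1
  have he1 : 1 ≤ Real.exp 1 := Real.one_le_exp zero_le_one
  have he3 := Real.exp_one_lt_three
  have hK0 : 0 < 4 * Real.exp 1 * (k : ℝ) := by positivity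
  have hK2 : 2 * (k : ℝ) ≤ 4 * Real.exp 1 * k := by gcongr; linarith
  have hK : 1 ≤ Real.log (4 * Real.exp 1 * (k : ℝ)) := by
    rw [Real.le_log_iff_exp_le hK0]
    nlinarith
  have h := fourierGen_le_abs_expectation_add hf hI
    (t := (30 * √((m : ℝ) * Real.log (4 * Real.exp 1 * (k : ℝ))))⁻¹)
    (inv_pos.mpr (by linarith)) (inv_le_one_of_one_le₀ hK)
  have hβ : 0 ≤ (1 - |expectation f|) / 2 := by
    have : |expectation f| ≤ 1 := by
      rw [expectation, abs_div, abs_of_pos (by positivity : (0 : ℝ) < 2 ^ n),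
        div_le_one (by positivity)]
      refine (Finset.abs_sum_le_sum_abs _ _).trans
        ((Finset.sum_le_sum fun x _ => abs_le.mpr (hf x)).trans_eq (by simp))
    linarith
  have hB := rpow_inv_one_add_inv_log_le hK hK0 hβ
  have ht : (30 * √((m : ℝ) * Real.log (4 * Real.exp 1 * (k : ℝ))))⁻¹ ^ 2
      / ((Real.log (4 * Real.exp 1 * (k : ℝ)))⁻¹ / 6) = 1 / (150 * (m : ℝ)) := by
    rw [inv_pow, mul_pow, Real.sq_sqrt (by positivity)]
    field_simp
    norm_num
  have hC := sqrt_one_add_pow_sub_one_le hm hIm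
  rw [ht] at h
  have h2 : 2 * (1 / (4 * Real.exp 1 * (k : ℝ))) ≤ 1 / k := by
    rw [mul_one_div, div_le_div_iff₀ hK0 (by linarith)]
    linarith
  -- `e / 3 ≤ 1`, so the nonempty sets contribute at most `2 (β + 1 / (4 e k))`
  have hprod := mul_le_mul hC hB (Real.rpow_nonneg hβ _) (by norm_num)
  have hlast : 1 / 3 * (Real.exp 1 * ((1 - |expectation f|) / 2 + 1 / (4 * Real.exp 1 * (k : ℝ))))
      ≤ (1 - |expectation f|) / 2 + 1 / (4 * Real.exp 1 * (k : ℝ)) := by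
    rw [← mul_assoc]
    exact mul_le_of_le_one_left (by positivity) (by linarith)
  linarith

/-! ### Product tests -/

theorem fourierWeight_prod_le {n k m d : ℕ} (hk : 0 < k) (hm : 0 < m) (hd : 1 ≤ d)
    {F : Fin k → Cube n → ℝ} {I : Fin k → Finset (Fin n)}
    (hF : ∀ i x, F i x ∈ Set.Icc (-1 : ℝ) 1) (hdep : ∀ i, DependsOn (F i) (I i))
    (hdisj : ∀ i j, i ≠ j → Disjoint (I i) (I j)) (hcard : ∀ i, (I i).card ≤ m) :
    fourierWeight 1 d (fun x => ∏ i, F i x)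
      ≤ (85 * √((m : ℝ) * Real.log (4 * Real.exp 1 * (k : ℝ)))) ^ d := by
  have hk' : (1 : ℝ) ≤ k := by exact_mod_cast hk
  have hm' : (0 : ℝ) < m := by exact_mod_cast hm
  have hlog : 0 < Real.log (4 * Real.exp 1 * (k : ℝ)) :=
    Real.log_pos (by nlinarith [Real.one_le_exp zero_le_one])
  have hR : 0 < √((m : ℝ) * Real.log (4 * Real.exp 1 * (k : ℝ))) := by positivity
  have hfactor := fun i => fourierGen_le_one_add_inv hk hm (hF i) (hdep i) (hcard i)
  generalize √((m : ℝ) * Real.log (4 * Real.exp 1 * (k : ℝ))) = R at *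
  have ht : 0 ≤ (30 * R)⁻¹ := by positivity
  have hmain : (30 * R)⁻¹ ^ d * fourierWeight 1 d (fun x => ∏ i, F i x) ≤ Real.exp 1 := by
    calc _ ≤ fourierGen (30 * R)⁻¹ (fun x => ∏ i, F i x) := pow_mul_fourierWeight_le ht d _
      _ ≤ ∏ i, fourierGen (30 * R)⁻¹ (F i) := fourierGen_prod_le ht hdep hdisj Finset.univ
      _ ≤ ∏ _i : Fin k, (1 + 1 / (k : ℝ)) :=
          Finset.prod_le_prod (fun i _ => fourierGen_nonneg ht (F i)) fun i _ => hfactor i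
      _ = (1 + 1 / (k : ℝ)) ^ k := by simp
      _ ≤ Real.exp (1 / k) ^ k := by
          gcongr
          rw [add_comm]
          exact Real.add_one_le_exp _
      _ = Real.exp 1 := by
          rw [← Real.exp_nat_mul]
          congr 1
          field_simp
  rw [inv_pow, inv_mul_le_iff₀ (by positivity)] at hmain
  calc _ ≤ (30 * R) ^ d * Real.exp 1 := hmain
    _ ≤ (30 * R) ^ d * (85 / 30) ^ d := by
        gcongr
        -- `e < 85 / 30`
        refine le_trans ?_ (le_self_pow₀ (by norm_num) (by omega))
        linarith [Real.exp_one_lt_d9]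
    _ = (85 * R) ^ d := by
        rw [← mul_pow]
        ring

end BoolCube

theorem theorem2 {n : ℕ} (k m d : ℕ) (hd : 1 ≤ d) (f : BoolCube.Cube n → ℝ)
    (hf : BoolCube.IsProductTest k m f) :
    BoolCube.fourierWeight 1 d f
      ≤ (85 * Real.sqrt ((m : ℝ) * Real.log (4 * Real.exp 1 * (k : ℝ)))) ^ d := by
  obtain ⟨I, hdisj, hcard, g, hg, hfg⟩ := hf
  obtain rfl : f = fun x => ∏ i, g i (fun j : I i => x j) := funext hfg
  have hdep : ∀ i, DependsOn (fun x : BoolCube.Cube n => g i (fun j : I i => x j)) (I i) :=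
    fun i x y h => congrArg (g i) (funext fun j => h j j.2)
  by_cases hkm : 0 < k ∧ 0 < m
  · exact BoolCube.fourierWeight_prod_le hkm.1 hkm.2 hd (fun i x => hg i _) hdep hdisj hcard
  · -- if `k = 0` or `m = 0` the bound is zero, and the product is constant
    have hempty : Finset.univ.biUnion I = ∅ := by
      refine Finset.subset_empty.mp (Finset.biUnion_subset.mpr fun i _ => ?_)
      have := hcard i
      have := i.pos
      rw [Finset.subset_empty, ← Finset.card_eq_zero]
      omega
    have hzero : BoolCube.fourierWeight 1 d
        (fun x : BoolCube.Cube n => ∏ i, g i (fun j : I i => x j)) = 0 := by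
      refine Finset.sum_eq_zero fun S hS => ?_
      rw [BoolCube.coeff_eq_zero_of_dependsOn (BoolCube.dependsOn_prod hdep Finset.univ)]
      · simp
      · rw [hempty, Finset.subset_empty, ← Finset.card_eq_zero,
          (Finset.mem_powersetCard.mp hS).2]
        omega
    rw [hzero]
    positivity
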